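/- **Theorem 1.2.** A *non-associative ring* is an additive group with a multiplication that is distributive over addition (neither associativity nor an identity is assumed); *ideal* means two-sided ideal. Such a ring is *left (right) artinian* if every descending sequence of left (right) ideals, i.e. of additive subgroups $I$ with $RI\subseteq I$ ($IR\subseteq I$), becomes stationary. Let $G$ be a groupoid (a small category in which every morphism is invertible). For a morphism $g$ write $d(g)$ and $c(g)$ for its domain and codomain, let $gh$ be defined when $d(g)=c(h)$, and identify an object $e$ with the identity morphism at $e$. A *partial action* $\alpha$ of $G$ on a non-associative ring $R$ is a family of ring isomorphisms $\alpha_g : R_{g^{-1}}\to R_g$, $g\in\mathrm{mor}(G)$, where $R_g$ is an ideal of $R_{c(g)}$ and $R_{c(g)}$ is an ideal of $R$, such that * (P1) $\alpha_e=\mathrm{id}_{R_e}$ for every object $e$; * (P2) $\alpha_h^{-1}(R_h\cap R_{g^{-1}})\subseteq R_{(gh)^{-1}}$ whenever $d(g)=c(h)$; * (P3) $\alpha_g(\alpha_h(x))=\alpha_{gh}(x)$ whenever $d(g)=c(h)$ and $x\in\alpha_h^{-1}(R_h\cap R_{g^{-1}})$; * (P4) $R=\bigoplus_{e\in\mathrm{ob}(G)}R_e$.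 The action is *global* if $\alpha_{gh}=\alpha_g\alpha_h$, as partially defined maps, whenever $d(g)=c(h)$ (equivalently, $R_g=R_{c(g)}$ for all $g$), and *unital* if every non-zero $R_g$ has a multiplicative identity. The *(partial) skew groupoid ring* $R\star_\alpha G$ consists of all finite formal sums $\sum_{g\in\mathrm{mor}(G)} r_g\delta_g$ with $r_g\in R_g$, with componentwise addition and the biadditive multiplication determined by $(r\delta_g)(s\delta_h)=\alpha_g(\alpha_{g^{-1}}(r)\,s)\,\delta_{gh}$ if $d(g)=c(h)$ and $(r\delta_g)(s\delta_h)=0$ otherwise, for $r\in R_g$ and $s\in R_h$. Let $\alpha$ be a global and unital action of a groupoid $G$ on a non-associative ring $R$. Then $R\star_\alpha G$ is left artinian if and only if $R$ is left artinian and $R_g=\{0\}$ for all but finitely many $g\in\mathrm{mor}(G)$. Likewise, $R\star_\alpha G$ is right artinian if and only if $R$ is right artinian and $R_g=\{0\}$ for all but finitely many $g\in\mathrm{mor}(G)$. -/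

import Mathlib

open CategoryTheory
open scoped DirectSum

/-! ### Non-associative rings and chain conditions

A non-associative ring (no identity, no associativity) is `NonUnitalNonAssocRing`;
a subring of it is a `NonUnitalSubring`. -/

/-- `I` is a (two-sided) ideal of the (not necessarily associative or unital) ring `J`,
both being subrings of an ambient ring `R`. -/
def IsIdealOf {R : Type*} [NonUnitalNonAssocRing R] (I J : NonUnitalSubring R) : Prop :=
  I ≤ J ∧ ∀ a ∈ J, ∀ x ∈ I, a * x ∈ I ∧ x * a ∈ I

/-- The subring `I` has a two-sided multiplicative identity of its own. -/
def HasIdentity {R : Type*} [NonUnitalNonAssocRing R] (I : NonUnitalSubring R) : Prop :=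
  ∃ u ∈ I, ∀ x ∈ I, u * x = x ∧ x * u = x

/-- A left ideal: a submodule of the ring as a left module over itself. -/
def IsLeftIdeal {R : Type*} [NonUnitalNonAssocRing R] (I : AddSubgroup R) : Prop :=
  ∀ r : R, ∀ x ∈ I, r * x ∈ I

/-- A right ideal: a submodule of the ring as a right module over itself. -/
def IsRightIdeal {R : Type*} [NonUnitalNonAssocRing R] (I : AddSubgroup R) : Prop :=
  ∀ r : R, ∀ x ∈ I, x * r ∈ I

/-- Left artinian: every descending sequence of left ideals becomes stationary. -/
def IsLeftArtinian (R : Type*) [NonUnitalNonAssocRing R] : Prop :=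
  ∀ I : ℕ → AddSubgroup R, (∀ n, IsLeftIdeal (I n)) → Antitone I →
    ∃ n, ∀ m, n ≤ m → I m = I n

/-- Right artinian: every descending sequence of right ideals becomes stationary. -/
def IsRightArtinian (R : Type*) [NonUnitalNonAssocRing R] : Prop :=
  ∀ I : ℕ → AddSubgroup R, (∀ n, IsRightIdeal (I n)) → Antitone I →
    ∃ n, ∀ m, n ≤ m → I m = I n

/-! ### Partial actions of groupoids

A groupoid is a type `G` of objects with an instance `Groupoid G`.  The composite `gh`
(first `h`, then `g`) of `h : a ⟶ b` and `g : b ⟶ c` is Mathlib's `h ≫ g`, and the object `e`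
is identified with the morphism `𝟙 e`. -/

open scoped Classical in
/-- A partial action of the groupoid `G` on the non-associative ring `R`: a family of ring
isomorphisms `α g : R_{g⁻¹} → R_g`, where `R_g` is written `D g`. -/
structure PartialGroupoidAction (G : Type*) [Groupoid G]
    (R : Type*) [NonUnitalNonAssocRing R] where
  /-- The subring `R_g`. -/
  D : ∀ {a b : G}, (a ⟶ b) → NonUnitalSubring R
  /-- `R_g` is an ideal of `R_{c(g)}`. -/
  D_ideal : ∀ {a b : G} (g : a ⟶ b), IsIdealOf (D g) (D (𝟙 b))
  /-- `R_e` is an ideal of `R` for each object `e`. -/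
  D_id_ideal : ∀ e : G, IsIdealOf (D (𝟙 e)) ⊤
  /-- The ring isomorphism `α_g : R_{g⁻¹} → R_g`. -/
  α : ∀ {a b : G} (g : a ⟶ b), D (Groupoid.inv g) ≃+* D g
  /-- (P1) `α_e` is the identity. -/
  α_id : ∀ (e : G) (x : D (Groupoid.inv (𝟙 e))), (α (𝟙 e) x : R) = x
  /-- (P2) `α_h⁻¹ (R_h ∩ R_{g⁻¹}) ⊆ R_{(gh)⁻¹}`. -/
  mem_comp : ∀ {a b c : G} (h : a ⟶ b) (g : b ⟶ c) (x : D (Groupoid.inv h)),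
    (α h x : R) ∈ D (Groupoid.inv g) → (x : R) ∈ D (Groupoid.inv (h ≫ g))
  /-- (P3) `α_g (α_h x) = α_{gh} x` for `x ∈ α_h⁻¹ (R_h ∩ R_{g⁻¹})`. -/
  α_comp : ∀ {a b c : G} (h : a ⟶ b) (g : b ⟶ c) (x : D (Groupoid.inv h))
    (hx : (α h x : R) ∈ D (Groupoid.inv g)),
    (α g ⟨α h x, hx⟩ : R) = α (h ≫ g) ⟨x, mem_comp h g x hx⟩
  /-- (P4) `R` is the internal direct sum of the `R_e`, for `e` an object of `G`. -/
  isInternal : DirectSum.IsInternal (fun e : G => D (𝟙 e))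

/-- The set `mor(G)` of all morphisms of `G`. -/
structure GroupoidMor (G : Type*) [Groupoid G] where
  /-- The domain. -/
  d : G
  /-- The codomain. -/
  c : G
  /-- The morphism itself. -/
  hom : d ⟶ c

/-- The composite `gh` of two composable morphisms (`d(g) = c(h)`). -/
def GroupoidMor.comp {G : Type*} [Groupoid G] (g h : GroupoidMor G) (e : h.c = g.d) :
    GroupoidMor G :=
  ⟨h.d, g.c, h.hom ≫ eqToHom e ≫ g.hom⟩

namespace PartialGroupoidAction

variable {G : Type*} [Groupoid G] {R : Type*} [NonUnitalNonAssocRing R]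
  (A : PartialGroupoidAction G R)

/-- The ideal `R_g`, for `g` in `mor(G)`. -/
def ideal (g : GroupoidMor G) : NonUnitalSubring R := A.D g.hom

/-- The action is global: `α_{gh} = α_g α_h` as partially defined maps whenever `gh` is defined,
that is, the two sides have the same domain of definition and the same values on it. -/
def IsGlobal : Prop :=
  ∀ {a b c : G} (h : a ⟶ b) (g : b ⟶ c),
    (∀ x : R, x ∈ A.D (Groupoid.inv (h ≫ g)) ↔
      ∃ hx : x ∈ A.D (Groupoid.inv h), (A.α h ⟨x, hx⟩ : R) ∈ A.D (Groupoid.inv g)) ∧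
    ∀ (x : R) (hx : x ∈ A.D (Groupoid.inv (h ≫ g))) (hx' : x ∈ A.D (Groupoid.inv h))
      (hx'' : (A.α h ⟨x, hx'⟩ : R) ∈ A.D (Groupoid.inv g)),
      (A.α (h ≫ g) ⟨x, hx⟩ : R) = A.α g ⟨A.α h ⟨x, hx'⟩, hx''⟩

/-- The action is unital: every non-zero `R_g` is a unital ring. -/
def IsUnital : Prop :=
  ∀ g : GroupoidMor G, A.ideal g ≠ ⊥ → HasIdentity (A.ideal g)

theorem mem_inv_inv {a b : G} (g : a ⟶ b) {r : R} (hr : r ∈ A.D g) :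
    r ∈ A.D (Groupoid.inv (Groupoid.inv g)) := by
  simpa using hr

theorem mul_mem_inv {g h : GroupoidMor G} (e : h.c = g.d) (x : A.D (Groupoid.inv g.hom))
    (s : A.ideal h) : (x : R) * s ∈ A.D (Groupoid.inv g.hom) := by
  obtain ⟨b, c, g⟩ := g
  obtain ⟨a, b', h⟩ := h
  obtain rfl : b' = b := e
  exact ((A.D_ideal (Groupoid.inv g)).2 s ((A.D_ideal h).1 s.2) x x.2).2

/-- The coefficient `α_g (α_{g⁻¹}(r) s)` of `(r δ_g) (s δ_h)`, as an element of `R`. -/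
def coeffMul {g h : GroupoidMor G} (e : h.c = g.d) (r : A.ideal g) (s : A.ideal h) : R :=
  A.α g.hom ⟨A.α (Groupoid.inv g.hom) ⟨r, A.mem_inv_inv g.hom r.2⟩ * s, A.mul_mem_inv e _ s⟩

theorem α_mem_comp {a b c : G} (h : a ⟶ b) (g : b ⟶ c) {y : R}
    (hg : y ∈ A.D (Groupoid.inv g)) (hh : y ∈ A.D h) : (A.α g ⟨y, hg⟩ : R) ∈ A.D (h ≫ g) := by
  have key := A.α_comp h g ((A.α h).symm ⟨y, hh⟩) (by simpa using hg)
  simp only [RingEquiv.apply_symm_apply] at key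
  rw [key]
  exact SetLike.coe_mem _

theorem coeffMul_mem {g h : GroupoidMor G} (e : h.c = g.d) (r : A.ideal g) (s : A.ideal h) :
    A.coeffMul e r s ∈ A.ideal (g.comp h e) := by
  obtain ⟨b, c, g⟩ := g
  obtain ⟨a, b', h⟩ := h
  obtain rfl : b' = b := e
  simp only [ideal, GroupoidMor.comp, eqToHom_refl, Category.id_comp]
  refine A.α_mem_comp h g _ ?_
  exact ((A.D_ideal h).2 _ ((A.D_ideal (Groupoid.inv g)).1 (SetLike.coe_mem _)) s s.2).1

theorem coeffMul_add {g h : GroupoidMor G} (e : h.c = g.d) (r : A.ideal g) (s t : A.ideal h) :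
    A.coeffMul e r (s + t) = A.coeffMul e r s + A.coeffMul e r t := by
  unfold coeffMul
  rw [← AddMemClass.coe_add, ← map_add]
  congr 2
  exact Subtype.ext (mul_add _ _ _)

theorem add_coeffMul {g h : GroupoidMor G} (e : h.c = g.d) (r r' : A.ideal g) (s : A.ideal h) :
    A.coeffMul e (r + r') s = A.coeffMul e r s + A.coeffMul e r' s := by
  unfold coeffMul
  rw [← AddMemClass.coe_add, ← map_add]
  congr 2
  refine Subtype.ext ?_
  refine Eq.trans ?_ (add_mul _ _ _)
  refine congrArg (· * (s : R)) ?_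
  rw [← AddMemClass.coe_add, ← map_add]
  rfl

/-- The biadditive map `(r, s) ↦ α_g (α_{g⁻¹}(r) s)` from `R_g × R_h` to `R_{gh}`. -/
def compMul {g h : GroupoidMor G} (e : h.c = g.d) :
    A.ideal g →+ A.ideal h →+ A.ideal (g.comp h e) :=
  AddMonoidHom.mk'
    (fun r => AddMonoidHom.mk' (fun s => ⟨A.coeffMul e r s, A.coeffMul_mem e r s⟩)
      fun s t => Subtype.ext (A.coeffMul_add e r s t))
    fun r r' => AddMonoidHom.ext fun s => Subtype.ext (A.add_coeffMul e r r' s)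

/-- The additive group of the partial skew groupoid ring: the finite formal sums
`∑ r_g δ_g` over `g` in `mor(G)`, with `r_g` in `R_g`. -/
def SkewRing : Type _ := ⨁ g : GroupoidMor G, A.ideal g

noncomputable instance : AddCommGroup A.SkewRing :=
  inferInstanceAs (AddCommGroup (⨁ g : GroupoidMor G, A.ideal g))

open scoped Classical in
/-- The element `r δ_g`, additively in `r`. -/
noncomputable def single (g : GroupoidMor G) : A.ideal g →+ A.SkewRing :=
  DirectSum.of (fun g : GroupoidMor G => A.ideal g) g

open scoped Classical in
/-- The product of `r δ_g` and `s δ_h`: it is `α_g (α_{g⁻¹}(r) s) δ_{gh}` if `g` and `h` are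
composable, and `0` otherwise. -/
noncomputable def mulSingle (g h : GroupoidMor G) :
    A.ideal g →+ A.ideal h →+ A.SkewRing :=
  if e : h.c = g.d then
    (A.single (g.comp h e)).compHom.comp (A.compMul e)
  else 0

open scoped Classical in
/-- The biadditive extension of `mulSingle` to all finite formal sums. -/
noncomputable def mulHom : A.SkewRing →+ A.SkewRing →+ A.SkewRing :=
  DirectSum.toAddMonoid fun g =>
    (DirectSum.toAddMonoid fun h => (A.mulSingle g h).flip).flip

/-- The partial skew groupoid ring `R ⋆_α G`. -/
noncomputable instance : NonUnitalNonAssocRing A.SkewRing where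
  mul x y := A.mulHom x y
  left_distrib x y z := map_add (A.mulHom x) y z
  right_distrib x y z := DFunLike.congr_fun (map_add A.mulHom x y) z
  zero_mul x := DFunLike.congr_fun (map_zero A.mulHom) x
  mul_zero x := map_zero (A.mulHom x)

theorem single_mul_single (g h : GroupoidMor G) (r : A.ideal g) (s : A.ideal h) :
    A.single g r * A.single h s = A.mulSingle g h r s := by
  classical
  refine (DFunLike.congr_fun (DirectSum.toAddMonoid_of (β := fun g => A.ideal g)
    (fun g => (DirectSum.toAddMonoid fun h => (A.mulSingle g h).flip).flip) g r)
    (A.single h s)).trans ?_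
  exact DFunLike.congr_fun (DirectSum.toAddMonoid_of (β := fun h => A.ideal h)
    (fun h => (A.mulSingle g h).flip) h s) r

/-- The multiplication rule for composable `g` and `h`. -/
theorem single_mul_single_of_comp {g h : GroupoidMor G} (e : h.c = g.d)
    (r : A.ideal g) (s : A.ideal h) :
    A.single g r * A.single h s =
      A.single (g.comp h e) ⟨A.coeffMul e r s, A.coeffMul_mem e r s⟩ := by
  rw [single_mul_single, mulSingle, dif_pos e]
  rfl

/-- The multiplication rule for non-composable `g` and `h`. -/
theorem single_mul_single_of_not_comp {g h : GroupoidMor G} (e : h.c ≠ g.d)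
    (r : A.ideal g) (s : A.ideal h) :
    A.single g r * A.single h s = 0 := by
  rw [single_mul_single, mulSingle, dif_neg e]
  rfl

end PartialGroupoidAction

/-! For a global action `R_g` is all of `R_{c(g)}`, and left multiplication by `r δ_k` turns the
coefficient at `m` into `r * α_k(x_{k⁻¹m})` when `c(m) = c(k)` and into `0` otherwise. Domains of
morphisms are thus preserved. Right multiplication takes the same shape after inverting morphisms
and transporting coefficients along `α`. `SkewCoordinates` records this shape for arbitrary
biadditive products, so `SkewCoordinates.chainCondition_iff` serves both sides, and associativity of
`R` is never needed.

Suppose the skew ring satisfies the chain condition. Restricting transported coefficients to an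
ideal of `R` passes the condition to `R`. If infinitely many `R_e` were non-zero, forbidding their
objects as domains one by one would give a strict chain. For a vertex group `Γ` at `e` with `R_e ≠
0`, an additive map `φ : R → k` with `φ(1_e) ≠ 0` and `k` equal to `ℚ` or `ZMod p` makes the left
ideals of `k[Γ]` visible inside the skew ring. So `k[Γ]` is artinian and `Γ` is finite by Connell's
theorem. Conversely, finite support embeds the skew ring in a finite power of `R`, on which diagonal
elements act coordinatewise.

Connell's theorem: subgroups of `Γ` embed strictly monotonically in left ideals of `k[Γ]`, so they
satisfy both chain conditions. Take a minimal infinite subgroup modulo a maximal finite normal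
subgroup. Its nontrivial elements have finite centralizers, so its group algebra is prime. Being
artinian, it is then semisimple, which is impossible for an infinite group. -/

/-! ### Artinian group algebras over fields -/

section GroupAlgebra

open MonoidAlgebra

variable (k : Type*) [Field k] {Γ : Type*} [Group Γ]

/-! ### Left ideals of a group algebra attached to subgroups -/

/-- The left ideal of the elements of `k[Γ]` whose coefficients sum to zero on each left coset
of `H`. -/
def cosetSumIdeal (H : Subgroup Γ) : Ideal (MonoidAlgebra k Γ) where
  carrier := {θ | Finsupp.mapDomain (QuotientGroup.mk : Γ → Γ ⧸ H) θ.coeff = 0}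
  add_mem' {a b} ha hb := by
    simp only [Set.mem_ofPred_eq] at *
    rw [coeff_add, Finsupp.mapDomain_add, ha, hb, add_zero]
  zero_mem' := by simp
  smul_mem' c θ hθ := by
    simp only [Set.mem_ofPred_eq, smul_eq_mul] at *
    induction c using MonoidAlgebra.induction_linear with
    | zero => simp
    | add a b ha hb => rw [add_mul, coeff_add, Finsupp.mapDomain_add, ha, hb, add_zero]
    | single g r =>
      have key : (single g r * θ).coeff = r • Finsupp.mapDomain (g * ·) θ.coeff := by
        ext m
        rw [coeff_single_mul_apply]
        have : m = g * (g⁻¹ * m) := by group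
        conv_rhs => rw [this]
        rw [Finsupp.smul_apply, Finsupp.mapDomain_apply (mul_right_injective g), smul_eq_mul]
      rw [key, Finsupp.mapDomain_smul, ← Finsupp.mapDomain_comp]
      have : (QuotientGroup.mk : Γ → Γ ⧸ H) ∘ (g * ·) = (g • ·) ∘ QuotientGroup.mk := rfl
      rw [this, Finsupp.mapDomain_comp, hθ, Finsupp.mapDomain_zero, smul_zero]

theorem mem_cosetSumIdeal {H : Subgroup Γ} {θ : MonoidAlgebra k Γ} :
    θ ∈ cosetSumIdeal k H ↔
      Finsupp.mapDomain (QuotientGroup.mk : Γ → Γ ⧸ H) θ.coeff = 0 := Iff.rfl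

theorem single_sub_one_mem_cosetSumIdeal {H : Subgroup Γ} {g : Γ} :
    (single g 1 - single 1 1 : MonoidAlgebra k Γ) ∈ cosetSumIdeal k H ↔ g ∈ H := by
  rw [mem_cosetSumIdeal, coeff_sub, Finsupp.mapDomain_sub, coeff_single, coeff_single,
    Finsupp.mapDomain_single, Finsupp.mapDomain_single, sub_eq_zero,
    Finsupp.single_left_inj one_ne_zero, eq_comm, QuotientGroup.eq]
  simp

theorem cosetSumIdeal_strictMono :
    StrictMono (cosetSumIdeal k : Subgroup Γ → Ideal (MonoidAlgebra k Γ)) := by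
  refine Monotone.strictMono_of_injective (fun H K hHK θ hθ => ?_) fun H K hHK => ?_
  · rw [mem_cosetSumIdeal] at *
    have : (QuotientGroup.mk : Γ → Γ ⧸ K) =
        (Subgroup.quotientMapOfLE hHK) ∘ (QuotientGroup.mk : Γ → Γ ⧸ H) := rfl
    rw [this, Finsupp.mapDomain_comp, hθ, Finsupp.mapDomain_zero]
  · ext g
    rw [← single_sub_one_mem_cosetSumIdeal k, hHK, single_sub_one_mem_cosetSumIdeal]

/-- The left ideal of `k[Γ]` induced from a left ideal of the group algebra of a subgroup. -/
def inducedIdeal (H : Subgroup Γ) (I : Ideal (MonoidAlgebra k H)) :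
    Ideal (MonoidAlgebra k Γ) where
  carrier := {θ | ∀ q : Γ, ∃ ι ∈ I, ∀ h : H, ι.coeff h = θ.coeff (q * h)}
  add_mem' {a b} ha hb q := by
    obtain ⟨ι, hι, h1⟩ := ha q
    obtain ⟨κ, hκ, h2⟩ := hb q
    exact ⟨ι + κ, I.add_mem hι hκ, fun h => by simp [h1, h2]⟩
  zero_mem' q := ⟨0, I.zero_mem, fun h => by simp⟩
  smul_mem' c θ hθ := by
    induction c using MonoidAlgebra.induction_linear with
    | zero => exact fun q => ⟨0, I.zero_mem, fun h => by simp⟩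
    | add a b ha hb =>
      intro q
      obtain ⟨ι, hι, h1⟩ := ha q
      obtain ⟨κ, hκ, h2⟩ := hb q
      exact ⟨ι + κ, I.add_mem hι hκ, fun h => by simp [h1, h2, add_mul]⟩
    | single g r =>
      intro q
      obtain ⟨ι, hι, h1⟩ := hθ (g⁻¹ * q)
      refine ⟨single 1 r * ι, I.mul_mem_left _ hι, fun h => ?_⟩
      rw [smul_eq_mul, coeff_single_mul_apply, coeff_single_mul_apply, inv_one, one_mul, h1,
        mul_assoc]

theorem inducedIdeal_strictMono (H : Subgroup Γ) : StrictMono (inducedIdeal k H) := by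
  refine Monotone.strictMono_of_injective (fun I J hIJ θ hθ q => ?_) fun I J hIJ => ?_
  · obtain ⟨ι, hι, h1⟩ := hθ q
    exact ⟨ι, hIJ hι, h1⟩
  -- Extension by zero from `H` to `Γ` detects `I`: on the coset `qH` the extended element is a
  -- translate of `θ` if `q ∈ H`, and zero otherwise.
  · have key : ∀ (I : Ideal (MonoidAlgebra k H)) (θ : MonoidAlgebra k H),
        (ofCoeff (θ.coeff.mapDomain (Subtype.val : H → Γ)) : MonoidAlgebra k Γ) ∈
          inducedIdeal k H I ↔ θ ∈ I := by
      intro I θ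
      constructor
      · intro h
        obtain ⟨ι, hι, h1⟩ := h 1
        have : ι = θ := by
          ext h
          rw [h1, one_mul, coeff_ofCoeff, Finsupp.mapDomain_apply Subtype.val_injective]
        rwa [← this]
      · intro hθ q
        by_cases hq : q ∈ H
        · refine ⟨single (⟨q, hq⟩ : H)⁻¹ 1 * θ, I.mul_mem_left _ hθ, fun h => ?_⟩
          rw [coeff_single_mul_apply, one_mul, inv_inv, coeff_ofCoeff]
          exact (Finsupp.mapDomain_apply Subtype.val_injective θ.coeff (⟨q, hq⟩ * h : H)).symm
        · refine ⟨0, I.zero_mem, fun h => ?_⟩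
          rw [coeff_ofCoeff, Finsupp.mapDomain_of_notMem_range]
          · simp
          · rintro ⟨h', hh'⟩
            exact hq (by simpa [hh'] using H.mul_mem h'.2 (H.inv_mem h.2))
    ext θ
    rw [← key I, hIJ, key]

theorem isArtinianRing_subgroup [IsArtinianRing (MonoidAlgebra k Γ)] (H : Subgroup Γ) :
    IsArtinianRing (MonoidAlgebra k H) :=
  (inducedIdeal_strictMono k H).wellFoundedLT

/-! ### Prime and semisimple group algebras -/

variable {k}

theorem coeff_mul_single_one_mul [DecidableEq Γ] (a b : MonoidAlgebra k Γ) (g m : Γ) :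
    (a * single g 1 * b).coeff m =
      ∑ x ∈ a.coeff.support, ∑ y ∈ b.coeff.support,
        if x * g * y = m then a.coeff x * b.coeff y else 0 := by
  conv_lhs => rw [← sum_coeff_single a, ← sum_coeff_single b]
  simp only [Finsupp.sum, Finset.sum_mul, Finset.mul_sum, single_mul_single, mul_one,
    coeff_sum, Finsupp.finsetSum_apply, coeff_single, Finsupp.single_apply]
  exact Finset.sum_comm

/-- If the centralizers of the nontrivial elements of an infinite group are finite, then its
group algebra over a field is prime. -/
theorem exists_mul_single_mul_ne_zero [Infinite Γ]
    (hΓ : ∀ x : Γ, x ≠ 1 → {g : Γ | g * x = x * g}.Finite) {a b : MonoidAlgebra k Γ}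
    (ha : a ≠ 0) (hb : b ≠ 0) : ∃ g : Γ, a * single g 1 * b ≠ 0 := by
  classical
  obtain ⟨x₀, hx₀⟩ := Finsupp.support_nonempty_iff.2 (mt coeff_eq_zero.1 ha)
  obtain ⟨y₀, hy₀⟩ := Finsupp.support_nonempty_iff.2 (mt coeff_eq_zero.1 hb)
  -- Two solutions `g`, `g₀` differ by `g * g₀⁻¹`, which centralizes `x₀⁻¹ * x ≠ 1`.
  have hfin : ∀ x y : Γ, x ≠ x₀ → {g : Γ | x * g * y = x₀ * g * y₀}.Finite := by
    intro x y hx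
    rcases Set.eq_empty_or_nonempty {g : Γ | x * g * y = x₀ * g * y₀} with h | ⟨g₀, hg₀⟩
    · rw [h]; exact Set.finite_empty
    · have hne : x₀⁻¹ * x ≠ 1 := fun h => hx (inv_mul_eq_one.1 h).symm
      refine Set.Finite.subset ((hΓ _ hne).image (· * g₀)) fun g hg => ?_
      refine ⟨g * g₀⁻¹, ?_, by simp⟩
      simp only [Set.mem_ofPred_eq] at hg hg₀ ⊢
      have e1 : x₀⁻¹ * x * g = g * (y₀ * y⁻¹) := by
        rw [mul_assoc, inv_mul_eq_iff_eq_mul, ← mul_assoc, ← mul_assoc, ← hg]; group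
      have e2 : x₀⁻¹ * x * g₀ = g₀ * (y₀ * y⁻¹) := by
        rw [mul_assoc, inv_mul_eq_iff_eq_mul, ← mul_assoc, ← mul_assoc, ← hg₀]; group
      have e3 : y₀ * y⁻¹ = g₀⁻¹ * (x₀⁻¹ * x) * g₀ := by rw [mul_assoc, e2]; group
      rw [e3] at e1
      calc g * g₀⁻¹ * (x₀⁻¹ * x) = g * (g₀⁻¹ * (x₀⁻¹ * x) * g₀) * g₀⁻¹ := by group
        _ = x₀⁻¹ * x * (g * g₀⁻¹) := by rw [← e1]; group
  have hbad : (⋃ x ∈ (a.coeff.support.erase x₀ : Finset Γ), ⋃ y ∈ b.coeff.support,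
      {g : Γ | x * g * y = x₀ * g * y₀}).Finite :=
    Set.Finite.biUnion (Finset.finite_toSet _) fun x hx =>
      Set.Finite.biUnion (Finset.finite_toSet _) fun y _ => hfin x y (Finset.ne_of_mem_erase hx)
  -- For `g` outside the bad set, only the pair `(x₀, y₀)` contributes to the coefficient of `a * g
  -- * b` at `x₀ * g * y₀`; when `x = x₀`, cancellation forces `y = y₀`.
  obtain ⟨g, hg⟩ := hbad.infinite_compl.nonempty
  refine ⟨g, fun h0 => ?_⟩
  have h1 := congrArg (fun θ => θ.coeff (x₀ * g * y₀)) h0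
  simp only [coeff_zero, Finsupp.coe_zero, Pi.zero_apply] at h1
  rw [coeff_mul_single_one_mul, Finset.sum_eq_single_of_mem x₀ hx₀,
    Finset.sum_eq_single_of_mem y₀ hy₀, if_pos rfl] at h1
  · exact mul_ne_zero (Finsupp.mem_support_iff.1 hx₀) (Finsupp.mem_support_iff.1 hy₀) h1
  · intro y _ hy
    exact if_neg fun h => hy (mul_left_cancel h)
  · intro x hx hxx
    refine Finset.sum_eq_zero fun y hy => if_neg fun h => hg ?_
    simp only [Set.mem_iUnion]
    exact ⟨x, Finset.mem_erase.2 ⟨hxx, hx⟩, y, hy, h⟩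

variable (k) in
-- A complement of the augmentation ideal consists of translation-invariant elements, because `g * y
-- - y` lies in both. Finite support in an infinite group makes these zero, yet the augmentation
-- ideal does not contain `1`.
theorem not_isSemisimpleRing_of_infinite [Infinite Γ] :
    ¬ IsSemisimpleRing (MonoidAlgebra k Γ) := by
  intro hss
  obtain ⟨I, hI⟩ := exists_isCompl (cosetSumIdeal k (⊤ : Subgroup Γ))
  have hzero : I = ⊥ := by
    rw [eq_bot_iff]
    intro y hy
    by_contra hy0
    replace hy0 : y ≠ 0 := fun h => hy0 (h ▸ Submodule.zero_mem _)
    have hinv : ∀ g : Γ, single g 1 * y = y := by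
      intro g
      have hmem : single g 1 * y - y ∈ I := I.sub_mem (I.mul_mem_left _ hy) hy
      have hmem' : single g 1 * y - y ∈ cosetSumIdeal k (⊤ : Subgroup Γ) := by
        clear hmem hy hy0
        rw [mem_cosetSumIdeal]
        induction y using MonoidAlgebra.induction_linear with
        | zero => simp
        | add a b ha hb =>
          rw [mul_add, add_sub_add_comm, coeff_add, Finsupp.mapDomain_add, ha, hb, add_zero]
        | single h r =>
          rw [single_mul_single, one_mul, coeff_sub, Finsupp.mapDomain_sub, coeff_single,
            coeff_single, Finsupp.mapDomain_single, Finsupp.mapDomain_single, sub_eq_zero]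
          congr 1
          exact QuotientGroup.eq.2 trivial
      have := Submodule.disjoint_def.1 hI.disjoint _ hmem' hmem
      exact sub_eq_zero.1 this
    obtain ⟨x₀, hx₀⟩ := Finsupp.support_nonempty_iff.2 (mt coeff_eq_zero.1 hy0)
    refine Set.infinite_univ (α := Γ) ((Finset.finite_toSet y.coeff.support).subset fun g _ => ?_)
    rw [Finset.mem_coe, Finsupp.mem_support_iff]
    have := congrArg (fun θ => θ.coeff g) (hinv (g * x₀⁻¹))
    simp only [coeff_single_mul_apply, one_mul, mul_inv_rev, inv_inv, inv_mul_cancel_right] at this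
    rw [← this]
    exact Finsupp.mem_support_iff.1 hx₀
  have htop : cosetSumIdeal k (⊤ : Subgroup Γ) = ⊤ := by
    have := hI.sup_eq_top
    rwa [hzero, sup_bot_eq] at this
  have h1 : (1 : MonoidAlgebra k Γ) ∈ cosetSumIdeal k (⊤ : Subgroup Γ) := htop ▸ trivial
  rw [mem_cosetSumIdeal, one_def, coeff_single, Finsupp.mapDomain_single,
    Finsupp.single_eq_zero] at h1
  exact one_ne_zero h1

variable (k) in
-- The Jacobson radical of an artinian ring is nilpotent, and primeness makes a nilpotent ideal
-- vanish, so an infinite `Γ` would have a semisimple group algebra.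
theorem finite_of_isArtinianRing_of_finite_centralizers [IsArtinianRing (MonoidAlgebra k Γ)]
    (hΓ : ∀ x : Γ, x ≠ 1 → {g : Γ | g * x = x * g}.Finite) : Finite Γ := by
  by_contra hfin
  rw [not_finite_iff_infinite] at hfin
  refine not_isSemisimpleRing_of_infinite k (Γ := Γ) ?_
  rw [IsArtinianRing.isSemisimpleRing_iff_jacobson]
  obtain ⟨n, hn⟩ := IsSemiprimaryRing.isNilpotent (R := MonoidAlgebra k Γ)
  rw [Submodule.zero_eq_bot] at hn
  -- If `J ≠ ⊥`, fix `a ≠ 0` in `J`. Every `b ∈ J ^ n` has `a * g * b ∈ J ^ (n + 1) = ⊥` for all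
  -- `g`, so `b = 0`; the exponent descends to `0`, where `J ^ 0 = ⊤`.
  induction n with
  | zero =>
    rw [Submodule.pow_zero, Ideal.one_eq_top] at hn
    exact absurd hn.symm bot_ne_top
  | succ n ih =>
    by_contra hJ
    obtain ⟨a, ha, ha0⟩ := (Submodule.ne_bot_iff _).1 hJ
    refine hJ (ih ?_)
    rw [Submodule.eq_bot_iff]
    intro b hb
    by_contra hb0
    obtain ⟨g, hg⟩ := exists_mul_single_mul_ne_zero hΓ ha0 hb0
    refine hg ?_
    rw [← Submodule.mem_bot (R := MonoidAlgebra k Γ), ← hn, Ideal.IsTwoSided.pow_succ, mul_assoc]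
    exact Ideal.mul_mem_mul ha (Ideal.mul_mem_left _ _ hb)

/-! ### Connell's theorem: reduction to finite centralizers -/

/-- An infinite centralizer would be the whole group, making the center nontrivial, hence infinite,
hence everything. Every nontrivial cyclic subgroup would then be normal and so the whole group,
which fails for `⟨x²⟩` in an infinite cyclic group. -/
theorem finite_centralizer_of_finite_subgroups [Infinite Γ]
    (hfin : ∀ H : Subgroup Γ, H ≠ ⊤ → Finite H)
    (hnormal : ∀ N : Subgroup Γ, N.Normal → Finite N → N = ⊥) {x : Γ} (hx : x ≠ 1) :
    {g : Γ | g * x = x * g}.Finite := by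
  by_cases hc : Subgroup.centralizer {x} = ⊤
  swap
  · have := hfin _ hc
    refine Set.Finite.subset (Set.toFinite (Subgroup.centralizer {x} : Set Γ)) fun g hg => ?_
    exact Subgroup.mem_centralizer_singleton_iff.2 hg
  exfalso
  have hxc : x ∈ Subgroup.center Γ := by
    rw [Subgroup.mem_center_iff]
    intro g
    exact Subgroup.mem_centralizer_singleton_iff.1 (hc ▸ Subgroup.mem_top g)
  have hcenter : Subgroup.center Γ = ⊤ := by
    by_contra h
    have := hnormal _ inferInstance (hfin _ h)
    rw [this, Subgroup.mem_bot] at hxc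
    exact hx hxc
  have htop : ∀ y : Γ, y ≠ 1 → Subgroup.zpowers y = ⊤ := by
    intro y hy
    by_contra h
    refine hy (Subgroup.zpowers_eq_bot.1 (hnormal _ ⟨fun n hn g => ?_⟩ (hfin _ h)))
    have : g * n = n * g := (Subgroup.mem_center_iff.1 (hcenter ▸ Subgroup.mem_top n) g)
    rwa [this, mul_inv_cancel_right]
  have hord : ¬ IsOfFinOrder x := by
    intro h
    have := h.finite_zpowers
    rw [htop x hx] at this
    exact not_finite_iff_infinite.2 ‹Infinite Γ› (Subgroup.topEquiv.toEquiv.finite_iff.1 this)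
  have hsq : x ^ (2 : ℤ) ≠ 1 := fun h =>
    hord (isOfFinOrder_iff_zpow_eq_one.2 ⟨2, two_ne_zero, h⟩)
  obtain ⟨m, hm⟩ := Subgroup.mem_zpowers_iff.1 (htop _ hsq ▸ Subgroup.mem_top x)
  -- From `x = (x ^ 2) ^ m`, the odd and therefore non-zero exponent `2 * m - 1` kills `x`.
  refine hord (isOfFinOrder_iff_zpow_eq_one.2 ⟨2 * m - 1, by omega, ?_⟩)
  rw [zpow_sub_one, zpow_mul, hm, mul_inv_cancel]

variable (k) in
theorem finite_of_isArtinianRing_of_finite_subgroups [IsArtinianRing (MonoidAlgebra k Γ)]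
    (hfin : ∀ H : Subgroup Γ, H ≠ ⊤ → Finite H) : Finite Γ := by
  by_contra hΓ
  rw [not_finite_iff_infinite] at hΓ
  -- Artinian rings are noetherian, so the ascending chain condition is available too.
  have hgt : WellFoundedGT (Subgroup Γ) := (cosetSumIdeal_strictMono k).wellFoundedGT
  obtain ⟨N, ⟨hN, hNfin⟩, hmax⟩ := hgt.wf.has_min
    {N : Subgroup Γ | N.Normal ∧ Finite N} ⟨⊥, inferInstance, inferInstance⟩
  have hsurj := QuotientGroup.mk'_surjective N
  have hcomap : ∀ H : Subgroup (Γ ⧸ N), Finite (H.comap (QuotientGroup.mk' N)) → Finite H := by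
    intro H h
    rw [← Subgroup.map_comap_eq_self_of_surjective hsurj H]
    exact Set.Finite.image _ h
  have hinf : Infinite (Γ ⧸ N) := by
    by_contra h
    rw [not_infinite_iff_finite] at h
    exact not_finite_iff_infinite.2 hΓ
      (Finite.of_equiv _ (Subgroup.groupEquivQuotientProdSubgroup (s := N)).symm)
  have hart : IsArtinianRing (MonoidAlgebra k (Γ ⧸ N)) := by
    refine Function.Surjective.isArtinianRing (R := MonoidAlgebra k Γ)
      (f := mapDomainRingHom k (QuotientGroup.mk' N)) fun θ => ?_
    induction θ using MonoidAlgebra.induction_linear with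
    | zero => exact ⟨0, map_zero _⟩
    | add a b ha hb =>
      obtain ⟨a', rfl⟩ := ha
      obtain ⟨b', rfl⟩ := hb
      exact ⟨a' + b', map_add _ _ _⟩
    | single g r =>
      obtain ⟨g, rfl⟩ := hsurj g
      exact ⟨single g r, by simp⟩
  refine not_finite_iff_infinite.2 hinf (finite_of_isArtinianRing_of_finite_centralizers k
    fun x hx => finite_centralizer_of_finite_subgroups (fun H hH => hcomap H (hfin _ ?_))
      (fun M hM hMfin => ?_) hx)
  · intro h
    refine hH ?_
    rw [← Subgroup.map_comap_eq_self_of_surjective hsurj H, h,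
      Subgroup.map_top_of_surjective _ hsurj]
  -- The preimage of a finite normal subgroup of `Γ ⧸ N` is finite, normal and contains `N`, so it
  -- equals `N` by maximality.
  · have hle : N ≤ M.comap (QuotientGroup.mk' N) := by
      conv_lhs => rw [← QuotientGroup.ker_mk' N]
      exact MonoidHom.ker_le_comap _ _
    have hMc : Finite (M.comap (QuotientGroup.mk' N)) := by
      have hpre : (QuotientGroup.mk' N ⁻¹' (M : Set (Γ ⧸ N))).Finite :=
        Set.Finite.preimage' (Set.toFinite (M : Set (Γ ⧸ N))) fun b _ => by
          obtain ⟨g, rfl⟩ := hsurj b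
          refine (((Set.toFinite (N : Set Γ)).image (g * ·)).subset fun y hy => ?_)
          exact ⟨g⁻¹ * y, QuotientGroup.eq.1 (Eq.symm hy), by simp⟩
      exact hpre
    have heq : N = M.comap (QuotientGroup.mk' N) := by
      by_contra hne
      exact hmax _ ⟨inferInstance, hMc⟩ (lt_of_le_of_ne hle hne)
    rw [← Subgroup.map_comap_eq_self_of_surjective hsurj M, ← heq, QuotientGroup.map_mk'_self]

/-- Connell's theorem over a field: a group whose group algebra is artinian is finite. -/
theorem finite_of_isArtinianRing_monoidAlgebra (k : Type*) [Field k] (Γ : Type*) [Group Γ]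
    [IsArtinianRing (MonoidAlgebra k Γ)] : Finite Γ := by
  by_contra hΓ
  rw [not_finite_iff_infinite] at hΓ
  have hlt : WellFoundedLT (Subgroup Γ) := (cosetSumIdeal_strictMono k).wellFoundedLT
  obtain ⟨H, hH, hmin⟩ := hlt.wf.has_min {H : Subgroup Γ | Infinite H}
    ⟨⊤, Subgroup.topEquiv.toEquiv.infinite_iff.2 hΓ⟩
  have := isArtinianRing_subgroup k H
  refine not_finite_iff_infinite.2 hH (finite_of_isArtinianRing_of_finite_subgroups k fun K hK => ?_)
  by_contra hKfin
  rw [not_finite_iff_infinite] at hKfin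
  refine hmin (K.map H.subtype) ?_ ?_
  · exact (K.equivMapOfInjective _ H.subtype_injective).toEquiv.infinite_iff.1 hKfin
  · refine lt_of_le_of_ne (Subgroup.map_subtype_le K) fun h => hK ?_
    rw [eq_top_iff]
    intro x _
    obtain ⟨y, hy, hxy⟩ := h.ge x.2
    rwa [← Subtype.ext hxy]

end GroupAlgebra

/-! ### Additive functionals with values in prime fields -/

theorem exists_addMonoidHom_zmod_apply_ne_zero (p : ℕ) [Fact p.Prime] {V : Type*}
    [AddCommGroup V] [Module (ZMod p) V] {v : V} (hv : v ≠ 0) :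
    ∃ f : V →+ ZMod p, f v ≠ 0 := by
  obtain ⟨f, hf⟩ := Module.Projective.exists_dual_ne_zero (ZMod p) hv
  exact ⟨f.toAddMonoidHom, hf⟩

/-- Let `v ≠ 0` be such that whenever `v` is divisible by `p`, a quotient can be found which is
annihilated by all integers annihilating `v`. Then some additive map to a prime field does not
vanish at `v`. -/
theorem exists_addMonoidHom_apply_ne_zero {R : Type*} [AddCommGroup R] {v : R} (hv : v ≠ 0)
    (hdiv : ∀ (p : ℕ) (a : R), v = p • a → ∃ b : R, v = p • b ∧ ∀ n : ℕ, n • v = 0 → n • b = 0) :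
    ∃ (k : Type) (_ : Field k) (φ : R →+ k), φ v ≠ 0 ∧
      ∀ s : Finset k, ∃ c : k, c ≠ 0 ∧ ∀ a ∈ s, ∃ n : ℤ, (n : k) = c * a := by
  by_cases hord : addOrderOf v = 0
  · have hinj : Function.Injective (zmultiplesHom R v) := by
      rw [injective_iff_map_eq_zero]
      intro n hn
      by_contra hn0
      exact addOrderOf_eq_zero_iff.1 hord (isOfFinAddOrder_iff_zsmul_eq_zero.2 ⟨n, hn0, hn⟩)
    -- Infinite order: `ℚ` is injective, so `n • v ↦ n` extends to `R`. The constant `c` below is a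
    -- common denominator.
    obtain ⟨φ, hφ⟩ := (Module.Baer.of_divisible ℚ).extension_property_addMonoidHom
      (zmultiplesHom R v) hinj (Int.castAddHom ℚ)
    refine ⟨ℚ, inferInstance, φ, ?_, fun s => ?_⟩
    · have := DFunLike.congr_fun hφ 1
      simp only [AddMonoidHom.comp_apply, zmultiplesHom_apply, one_zsmul] at this
      rw [this]
      simp
    · obtain ⟨b, hb⟩ := IsLocalization.exist_integer_multiples_of_finset (nonZeroDivisors ℤ) s
      refine ⟨((b : ℤ) : ℚ), by simp, fun a ha => ?_⟩
      obtain ⟨n, hn⟩ := hb a ha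
      exact ⟨n, by simpa using hn⟩
  · have hne : addOrderOf v ≠ 1 := fun h => hv (AddMonoid.addOrderOf_eq_one_iff.1 h)
    have hp : Fact (addOrderOf v).minFac.Prime := ⟨Nat.minFac_prime hne⟩
    obtain ⟨m, hm⟩ := Nat.minFac_dvd (addOrderOf v)
    set p := (addOrderOf v).minFac
    let P : AddSubgroup R := (nsmulAddMonoidHom (α := R) p).range
    -- If `v = p • b` with `b` killed by the order `p * m` of `v`, then `m • v = 0`, contradicting
    -- `m < p * m`. So `v` survives in the `ZMod p`-space `R ⧸ p R`.
    have hvP : (QuotientAddGroup.mk v : R ⧸ P) ≠ 0 := by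
      rw [Ne, QuotientAddGroup.eq_zero_iff]
      rintro ⟨a, ha⟩
      obtain ⟨b, hb, hb'⟩ := hdiv p a ha.symm
      have h1 : m • v = 0 := by
        rw [hb, ← mul_nsmul', mul_comm, ← hm]
        exact hb' _ (addOrderOf_nsmul_eq_zero v)
      have h2 := Nat.le_of_dvd (Nat.pos_of_ne_zero (by rintro rfl; simp [hm] at hord))
        (addOrderOf_dvd_of_nsmul_eq_zero h1)
      have h3 : 0 < m := Nat.pos_of_ne_zero (by rintro rfl; simp [hm] at hord)
      have h4 := hp.1.two_le
      nlinarith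
    obtain ⟨f, hf⟩ := @exists_addMonoidHom_zmod_apply_ne_zero p _ (R ⧸ P) _
      (QuotientAddGroup.zmodModule fun x => ⟨x, rfl⟩) _ hvP
    refine ⟨ZMod p, inferInstance, f.comp (QuotientAddGroup.mk' P), hf,
      fun s => ⟨1, one_ne_zero, fun a _ => ?_⟩⟩
    obtain ⟨n, hn⟩ := ZMod.intCast_surjective a
    exact ⟨n, by simp [hn]⟩

/-! ### Descending chain conditions for biadditive operations -/

/-- Every descending sequence of subgroups stable under `op r`, for all `r`, is stationary. -/
def ChainCondition {S : Type*} [AddCommGroup S] (op : S →+ S →+ S) : Prop :=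
  ∀ I : ℕ → AddSubgroup S, (∀ n, ∀ r, ∀ x ∈ I n, op r x ∈ I n) → Antitone I →
    ∃ n, ∀ m, n ≤ m → I m = I n

/-- Coordinates on an additive group `S` with an operation `opS` that make it look like the skew
groupoid ring of a global unital action of `G` on the additive group `R` with operation `opR`. -/
structure SkewCoordinates (G : Type*) [Groupoid G] {R S : Type*} [AddCommGroup R]
    [AddCommGroup S] (opR : R →+ R →+ R) (opS : S →+ S →+ S) where
  /-- The action of morphisms; the identity at `e` acts as the projection to the component at
  `e`. -/
  act : ∀ {a b : G}, (a ⟶ b) → R →+ R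
  /-- The identities of the components. -/
  one : G → R
  /-- The coordinates. -/
  coord : ∀ {a b : G}, (a ⟶ b) → S →+ R
  /-- The elements concentrated at one morphism. -/
  single : ∀ {a b : G}, (a ⟶ b) → R →+ S
  act_act : ∀ {a b c : G} (h : a ⟶ b) (g : b ⟶ c) (r : R), act g (act h r) = act (h ≫ g) r
  act_op : ∀ {a b : G} (g : a ⟶ b) (r s : R), act g (opR r s) = opR (act g r) (act g s)
  op_one : ∀ (e : G) (r : R), opR (one e) r = act (𝟙 e) r
  eq_sum : ∀ r : R, ∃ E : Finset G, r = ∑ e ∈ E, act (𝟙 e) r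
  act_coord : ∀ {a b : G} (m : a ⟶ b) (x : S), act (𝟙 b) (coord m x) = coord m x
  coord_single : ∀ {a b : G} (m : a ⟶ b) (r : R), coord m (single m r) = act (𝟙 b) r
  coord_single_ne : ∀ {a b a' b' : G} (m : a ⟶ b) (m' : a' ⟶ b') (r : R),
    (⟨a, b, m⟩ : GroupoidMor G) ≠ ⟨a', b', m'⟩ → coord m (single m' r) = 0
  coord_op_single : ∀ {a b c : G} (m : a ⟶ c) (k : b ⟶ c) (r : R) (x : S),
    coord m (opS (single k r) x) = opR r (act k (coord (m ≫ Groupoid.inv k) x))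
  coord_op_single_ne : ∀ {a b c c' : G} (m : a ⟶ c) (k : b ⟶ c') (r : R) (x : S), c ≠ c' →
    coord m (opS (single k r) x) = 0
  ext_zero : ∀ x : S, (∀ (a b : G) (m : a ⟶ b), coord m x = 0) → x = 0
  mem_closure : ∀ x : S, x ∈ AddSubgroup.closure {y | ∃ (a b : G) (m : a ⟶ b) (r : R),
    single m r = y}

namespace SkewCoordinates

variable {G : Type*} [Groupoid G] {R S : Type*} [AddCommGroup R] [AddCommGroup S]
  {opR : R →+ R →+ R} {opS : S →+ S →+ S} (C : SkewCoordinates G opR opS)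

include C in
theorem op_mem_of_single {I : AddSubgroup S} (h : ∀ {a b : G} (k : a ⟶ b) (r : R), ∀ x ∈ I,
    opS (C.single k r) x ∈ I) (s x : S) (hx : x ∈ I) : opS s x ∈ I := by
  induction C.mem_closure s using AddSubgroup.closure_induction with
  | mem s hs =>
    obtain ⟨a, b, k, r, rfl⟩ := hs
    exact h k r x hx
  | zero => simp
  | add s t _ _ hs ht => rw [map_add, AddMonoidHom.add_apply]; exact I.add_mem hs ht
  | neg s _ hs => rw [map_neg, AddMonoidHom.neg_apply]; exact I.neg_mem hs

theorem coord_eq_zero {a b : G} (m : a ⟶ b) (hb : C.act (𝟙 b) = 0) (x : S) : C.coord m x = 0 := by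
  rw [← C.act_coord, hb, AddMonoidHom.zero_apply]

theorem act_id_eq_zero {a b : G} (m : a ⟶ b) (hb : C.act (𝟙 b) = 0) : C.act (𝟙 a) = 0 := by
  ext r
  have h : C.act (Groupoid.inv m) (C.act (𝟙 b) (C.act m r)) = C.act (𝟙 a) r := by
    rw [C.act_act, C.act_act]; simp
  rw [← h, hb]; simp

/-! #### The chain condition passes to the ring -/

/-- The subgroup of the elements whose coordinates, transported to the domain, lie in `I`. -/
def lift (I : AddSubgroup R) : AddSubgroup S where
  carrier := {x | ∀ (a b : G) (m : a ⟶ b), C.act (Groupoid.inv m) (C.coord m x) ∈ I}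
  add_mem' hx hy a b m := by rw [map_add, map_add]; exact I.add_mem (hx a b m) (hy a b m)
  zero_mem' a b m := by simp
  neg_mem' hx a b m := by rw [map_neg, map_neg]; exact I.neg_mem (hx a b m)

/-- Multiplying by `r δ_k` and transporting to the domain yields `α_{m⁻¹}(r)` times the transported
coordinate at `k⁻¹m`, because the action is multiplicative. -/
theorem op_mem_lift {I : AddSubgroup R} (hI : ∀ r, ∀ x ∈ I, opR r x ∈ I) (s x : S)
    (hx : x ∈ C.lift I) : opS s x ∈ C.lift I := by
  refine C.op_mem_of_single (I := C.lift I) (fun {c d} k r x hx a b m => ?_) s x hx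
  by_cases hbd : b = d
  · subst hbd
    rw [C.coord_op_single, C.act_op, C.act_act]
    have := hx _ _ (m ≫ Groupoid.inv k)
    simp only [Groupoid.inv_eq_inv, IsIso.inv_comp, IsIso.inv_inv] at this ⊢
    exact hI _ _ this
  · rw [C.coord_op_single_ne m k r x hbd, map_zero]; exact I.zero_mem

theorem mem_of_act_id_mem {I : AddSubgroup R} {r : R} (h : ∀ e, C.act (𝟙 e) r ∈ I) : r ∈ I := by
  obtain ⟨E, hE⟩ := C.eq_sum r
  rw [hE]
  exact I.sum_mem fun e _ => h e

theorem le_of_lift_le {I J : AddSubgroup R} (hI : ∀ r, ∀ x ∈ I, opR r x ∈ I)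
    (h : C.lift I ≤ C.lift J) : I ≤ J := by
  refine fun r hr => C.mem_of_act_id_mem fun e => ?_
  -- The only coordinate of `r δ_e` is `1_e * r`, which lies in `I` by stability.
  have hmem : C.single (𝟙 e) r ∈ C.lift I := by
    intro a b m
    by_cases hm : (⟨a, b, m⟩ : GroupoidMor G) = ⟨e, e, 𝟙 e⟩
    · cases hm
      rw [C.coord_single, C.act_act]
      simp only [Groupoid.inv_eq_inv, IsIso.inv_id, Category.comp_id, ← C.op_one]
      exact hI _ _ hr
    · rw [C.coord_single_ne _ _ _ hm, map_zero]; exact I.zero_mem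
  have := h hmem e e (𝟙 e)
  rw [C.coord_single, C.act_act] at this
  simpa using this

include C in
theorem chainCondition_base (h : ChainCondition opS) : ChainCondition opR := by
  intro I hI hanti
  obtain ⟨n, hn⟩ := h (fun n => C.lift (I n)) (fun n => C.op_mem_lift (hI n))
    fun i j hij x hx a b m => hanti hij (hx a b m)
  exact ⟨n, fun m hm => le_antisymm (C.le_of_lift_le (hI m) (hn m hm).le)
    (C.le_of_lift_le (hI n) (hn m hm).ge)⟩

/-! #### Finiteness of the set of objects -/

include C in
theorem finite_objects (h : ChainCondition opS) : {e : G | C.act (𝟙 e) ≠ 0}.Finite := by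
  by_contra hinf
  let f := Set.Infinite.natEmbedding _ hinf
  -- `J n` forbids the domains `f 0, …, f (n - 1)`. If `J (n + 1) = J n`, the elements `r δ_{f n}`
  -- of `J n` vanish, so the component at `f n` is zero.
  let J : ℕ → AddSubgroup S := fun n =>
    { carrier := {x | ∀ i < n, ∀ (b : G) (m : (f i : G) ⟶ b), C.coord m x = 0}
      add_mem' := fun hx hy i hi b m => by rw [map_add, hx i hi b m, hy i hi b m, add_zero]
      zero_mem' := fun i hi b m => map_zero _
      neg_mem' := fun hx i hi b m => by rw [map_neg, hx i hi b m, neg_zero] }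
  obtain ⟨n, hn⟩ := h J
    (fun n s x hx => C.op_mem_of_single (I := J n) (fun {c d} k r x hx i hi b m => by
      by_cases hbd : b = d
      · subst hbd
        rw [C.coord_op_single, hx i hi, map_zero, map_zero]
      · exact C.coord_op_single_ne m k r x hbd) s x hx)
    fun i j hij x hx l hl => hx l (hl.trans_le hij)
  refine (f n).2 (AddMonoidHom.ext fun r => ?_)
  have hmem : C.single (𝟙 (f n : G)) r ∈ J n := by
    intro i hi b m
    refine C.coord_single_ne _ _ _ fun hm => hi.ne (f.injective (Subtype.ext ?_))
    exact congrArg GroupoidMor.d hm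
  rw [← hn (n + 1) n.le_succ] at hmem
  have := hmem n n.lt_succ_self _ (𝟙 _)
  rwa [C.coord_single] at this

/-! #### Finiteness of the vertex groups -/

/-- The subgroup of `S` attached to a left ideal of the group algebra of a vertex group. -/
def groupAlgebraLift (k : Type*) [Field k] (e : G) (I : Ideal (MonoidAlgebra k (End e))) :
    AddSubgroup S where
  carrier := {x | ∀ (b : G) (q : e ⟶ b) (φ : R →+ k), ∃ θ ∈ I, ∀ g : End e,
    θ.coeff g = φ (C.coord (g.asHom ≫ q) x)}
  add_mem' hx hy b q φ := by
    obtain ⟨θ, hθ, h1⟩ := hx b q φ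
    obtain ⟨η, hη, h2⟩ := hy b q φ
    exact ⟨θ + η, I.add_mem hθ hη, fun g => by simp [h1, h2]⟩
  zero_mem' b q φ := ⟨0, I.zero_mem, fun g => by simp⟩
  neg_mem' hx b q φ := by
    obtain ⟨θ, hθ, h1⟩ := hx b q φ
    exact ⟨-θ, I.neg_mem hθ, fun g => by simp [h1]⟩

/-- Quantifying over all `q` and `φ` is what gives stability: multiplication by `r δ_l` replaces `q`
by `l⁻¹q` and `φ` by `φ ∘ (r * ·) ∘ α_l`, so the same `θ` serves. -/
theorem op_mem_groupAlgebraLift {k : Type*} [Field k] {e : G}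
    (I : Ideal (MonoidAlgebra k (End e))) (s x : S) (hx : x ∈ C.groupAlgebraLift k e I) :
    opS s x ∈ C.groupAlgebraLift k e I := by
  refine C.op_mem_of_single (I := C.groupAlgebraLift k e I) (fun {c d} l r x hx b q φ => ?_) s x hx
  by_cases hbd : b = d
  · subst hbd
    obtain ⟨θ, hθ, h1⟩ := hx _ (q ≫ Groupoid.inv l) ((φ.comp (opR r)).comp (C.act l))
    refine ⟨θ, hθ, fun g => ?_⟩
    rw [h1, C.coord_op_single, Category.assoc]
    rfl
  · exact ⟨0, I.zero_mem, fun g => by rw [C.coord_op_single_ne _ l r x hbd]; simp⟩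

theorem le_of_groupAlgebraLift_le {k : Type*} [Field k] {e : G} {φ : R →+ k}
    (hφ : φ (C.act (𝟙 e) (C.one e)) ≠ 0)
    (hk : ∀ s : Finset k, ∃ c : k, c ≠ 0 ∧ ∀ a ∈ s, ∃ n : ℤ, (n : k) = c * a)
    {I J : Ideal (MonoidAlgebra k (End e))}
    (h : C.groupAlgebraLift k e I ≤ C.groupAlgebraLift k e J) : I ≤ J := by
  classical
  intro θ hθ
  obtain ⟨c, hc, hn⟩ := hk (θ.coeff.support.image θ.coeff)
  have hn' : ∀ g : End e, ∃ n : ℤ, (n : k) = c * θ.coeff g := by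
    intro g
    by_cases hg : g ∈ θ.coeff.support
    · exact hn _ (Finset.mem_image_of_mem _ hg)
    · exact ⟨0, by simp [Finsupp.notMem_support_iff.1 hg]⟩
  choose n hn using hn'
  -- Only integer multiples of `1_e` can be formed in `R`, so `c` first clears the denominators of
  -- `θ`. Applying any `φ` to the coordinates of `x` gives `φ(1_e) * c * θ`.
  let x : S := ∑ g ∈ θ.coeff.support, C.single g.asHom (n g • C.one e)
  have hx : ∀ (φ : R →+ k) (g : End e), φ (C.coord g.asHom x) =
      φ (C.act (𝟙 e) (C.one e)) * c * θ.coeff g := by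
    intro φ g
    rw [map_sum, mul_assoc, ← hn]
    by_cases hg : g ∈ θ.coeff.support
    · rw [Finset.sum_eq_single_of_mem g hg, C.coord_single, map_zsmul, map_zsmul, zsmul_eq_mul,
        mul_comm]
      intro g' _ hg'
      refine C.coord_single_ne _ _ _ fun hm => hg' ?_
      cases hm; rfl
    · rw [hn, Finsupp.notMem_support_iff.1 hg, mul_zero, mul_zero, Finset.sum_eq_zero, map_zero]
      intro g' hg'
      refine C.coord_single_ne _ _ _ fun hm => hg ?_
      cases hm; exact hg'
  have hxI : x ∈ C.groupAlgebraLift k e I := by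
    intro b q φ
    by_cases hb : b = e
    · subst hb
      refine ⟨MonoidAlgebra.single (End.of q)⁻¹ (φ (C.act (𝟙 b) (C.one b)) * c) * θ,
        I.mul_mem_left _ hθ, fun g => ?_⟩
      rw [MonoidAlgebra.coeff_single_mul_apply, inv_inv]
      exact (hx φ _).symm
    · refine ⟨0, I.zero_mem, fun g => ?_⟩
      rw [map_sum, Finset.sum_eq_zero]
      · simp
      · exact fun g' _ => C.coord_single_ne _ _ _ fun hm => hb (congrArg GroupoidMor.c hm)
  obtain ⟨η, hη, h1⟩ := h hxI e (𝟙 e) φ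
  have : η = MonoidAlgebra.single 1 (φ (C.act (𝟙 e) (C.one e)) * c) * θ := by
    ext g
    rw [h1, MonoidAlgebra.coeff_single_mul_apply, inv_one, one_mul, Category.comp_id, hx]
  rw [this] at hη
  have := J.mul_mem_left (MonoidAlgebra.single 1 (φ (C.act (𝟙 e) (C.one e)) * c)⁻¹) hη
  rwa [← mul_assoc, MonoidAlgebra.single_mul_single, inv_mul_cancel₀ (mul_ne_zero hφ hc),
    one_mul, ← MonoidAlgebra.one_def, one_mul] at this

include C in
theorem finite_end (h : ChainCondition opS) {e : G} (he : C.act (𝟙 e) ≠ 0) : Finite (End e) := by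
  have hop : ∀ r, opR (C.act (𝟙 e) (C.one e)) (C.act (𝟙 e) r) = C.act (𝟙 e) r := by
    intro r
    rw [← C.act_op, C.op_one, C.act_act, Category.comp_id]
  have hv : C.act (𝟙 e) (C.one e) ≠ 0 := by
    intro h0
    refine he (AddMonoidHom.ext fun r => ?_)
    rw [← hop, h0, map_zero, AddMonoidHom.zero_apply, AddMonoidHom.zero_apply]
  obtain ⟨k, _, φ, hφ, hk⟩ := exists_addMonoidHom_apply_ne_zero hv fun p a hpa => by
    -- The quotient is projected to the component at `e`, where `1_e` acts as identity; hence `n •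
    -- 1_e = 0` kills it.
    refine ⟨C.act (𝟙 e) a, ?_, fun n hn => ?_⟩
    · rw [← map_nsmul, ← hpa, C.act_act, Category.comp_id]
    · rw [← hop, ← AddMonoidHom.nsmul_apply, ← map_nsmul, hn, map_zero, AddMonoidHom.zero_apply]
  have : IsArtinianRing (MonoidAlgebra k (End e)) := by
    rw [IsArtinianRing, ← monotone_stabilizes_iff_artinian]
    intro f
    obtain ⟨n, hn⟩ := h (fun n => C.groupAlgebraLift k e (OrderDual.ofDual (f n)))
      (fun n => C.op_mem_groupAlgebraLift _) fun i j hij x hx b q φ => by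
        obtain ⟨θ, hθ, h1⟩ := hx b q φ
        exact ⟨θ, f.monotone hij hθ, h1⟩
    exact ⟨n, fun m hm => le_antisymm (C.le_of_groupAlgebraLift_le hφ hk (hn m hm).le)
      (C.le_of_groupAlgebraLift_le hφ hk (hn m hm).ge)⟩
  exact finite_of_isArtinianRing_monoidAlgebra k (End e)

include C in
theorem finite_morphisms (h : ChainCondition opS) :
    {m : GroupoidMor G | C.act (𝟙 m.c) ≠ 0}.Finite := by
  have hobj := C.finite_objects h
  have hhom : ∀ a b : G, C.act (𝟙 a) ≠ 0 →
      (Set.range fun m : a ⟶ b => (⟨a, b, m⟩ : GroupoidMor G)).Finite := by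
    intro a b ha
    have hend : Finite (a ⟶ a) := C.finite_end h ha
    rcases isEmpty_or_nonempty (a ⟶ b) with _ | ⟨⟨q⟩⟩
    · rw [Set.range_eq_empty]; exact Set.finite_empty
    -- Composing with a fixed `q⁻¹` embeds the hom-set in the vertex group at `a`.
    · have : Finite (a ⟶ b) := Finite.of_injective (fun m : a ⟶ b => m ≫ Groupoid.inv q)
        fun m m' hm => by simpa using hm
      exact Set.finite_range _
  refine (hobj.biUnion fun a ha => hobj.biUnion fun b _ => hhom a b ha).subset ?_
  rintro ⟨a, b, m⟩ hb
  have ha : C.act (𝟙 a) ≠ 0 := fun h0 => hb (C.act_id_eq_zero (Groupoid.inv m) h0)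
  simp only [Set.mem_iUnion]
  exact ⟨a, ha, b, hb, m, rfl⟩

/-! #### The chain condition passes to the skew groupoid ring -/

include C in
theorem chainCondition_of_finite (h : ChainCondition opR)
    (hfin : {m : GroupoidMor G | C.act (𝟙 m.c) ≠ 0}.Finite) : ChainCondition opS := by
  classical
  let F := {m : GroupoidMor G | C.act (𝟙 m.c) ≠ 0}
  have : Finite F := hfin
  let E : Finset G := hfin.toFinset.image GroupoidMor.c
  -- The multiplications generate an associative ring `Λ` over which `R` is an artinian module, and
  -- so is the finite power `F → R`.
  let Λ : Subring (AddMonoid.End R) := Subring.closure (Set.range fun r => (opR r : AddMonoid.End R))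
  have hart : IsArtinian Λ R := by
    rw [← monotone_stabilizes_iff_artinian]
    intro f
    obtain ⟨n, hn⟩ := h (fun n => (OrderDual.ofDual (f n)).toAddSubgroup)
      (fun n r x hx => (OrderDual.ofDual (f n)).smul_mem
        (⟨_, Subring.subset_closure ⟨r, rfl⟩⟩ : Λ) hx)
      fun i j hij x hx => f.monotone hij hx
    exact ⟨n, fun m hm => (Submodule.toAddSubgroup_injective (hn m hm)).symm⟩
  let Φ : S →+ (F → R) :=
    { toFun := fun x m => C.coord m.1.hom x
      map_zero' := by ext; simp
      map_add' := fun x y => by ext; simp }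
  have hΦ : Function.Injective Φ := by
    rw [injective_iff_map_eq_zero]
    refine fun x hx => C.ext_zero x fun a b m => ?_
    by_cases hb : C.act (𝟙 b) = 0
    · exact C.coord_eq_zero m hb x
    · exact congrFun hx ⟨⟨a, b, m⟩, hb⟩
  -- The finite sum of the `r δ_e` over all relevant codomains multiplies every coordinate by `r`,
  -- so images of stable subgroups are `Λ`-submodules.
  have hop : ∀ (r : R) (x : S),
      Φ (opS (∑ e ∈ E, C.single (𝟙 e) r) x) = fun m => opR r (Φ x m) := by
    intro r x
    ext ⟨⟨a, b, m⟩, hb⟩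
    have hbE : b ∈ E := Finset.mem_image_of_mem GroupoidMor.c
      (hfin.mem_toFinset.2 hb : (⟨a, b, m⟩ : GroupoidMor G) ∈ _)
    change C.coord m _ = opR r (C.coord m x)
    rw [map_sum, AddMonoidHom.finsetSum_apply, map_sum, Finset.sum_eq_single_of_mem b hbE,
      C.coord_op_single]
    · simp [C.act_coord]
    · exact fun e _ he => C.coord_op_single_ne _ _ _ _ (Ne.symm he)
  intro I hI hanti
  have hsmul : ∀ (n : ℕ) (c : AddMonoid.End R), c ∈ Λ → ∀ y ∈ (I n).map Φ,
      (fun m => c (y m)) ∈ (I n).map Φ := by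
    intro n c hc
    induction hc using Subring.closure_induction with
    | mem c hc =>
      obtain ⟨r, rfl⟩ := hc
      rintro _ ⟨x, hx, rfl⟩
      exact ⟨_, hI n _ x hx, hop r x⟩
    | zero => exact fun y _ => ((I n).map Φ).zero_mem
    | one => exact fun y hy => hy
    | add c d _ _ hc hd => exact fun y hy => ((I n).map Φ).add_mem (hc y hy) (hd y hy)
    | neg c _ hc => exact fun y hy => ((I n).map Φ).neg_mem (hc y hy)
    | mul c d _ _ hc hd => exact fun y hy => hc _ (hd y hy)
  let M : ℕ → Submodule Λ (F → R) := fun n =>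
    { (I n).map Φ with smul_mem' := fun c y hy => hsmul n c c.2 y hy }
  obtain ⟨n, hn⟩ := IsArtinian.monotone_stabilizes (R := Λ) (M := F → R)
    ⟨fun n => OrderDual.toDual (M n), fun i j hij => AddSubgroup.map_mono (hanti hij)⟩
  refine ⟨n, fun m hm => AddSubgroup.map_injective hΦ ?_⟩
  exact congrArg Submodule.toAddSubgroup (hn m hm).symm

include C in
theorem chainCondition_iff : ChainCondition opS ↔
    ChainCondition opR ∧ {m : GroupoidMor G | C.act (𝟙 m.c) ≠ 0}.Finite :=
  ⟨fun h => ⟨C.chainCondition_base h, C.finite_morphisms h⟩,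
    fun h => C.chainCondition_of_finite h.1 h.2⟩

end SkewCoordinates

namespace PartialGroupoidAction

variable {G : Type*} [Groupoid G] {R : Type*} [NonUnitalNonAssocRing R]
  {A : PartialGroupoidAction G R}

/-! ### The components of the ring -/

theorem mul_mem_left_D_id {e : G} (r : R) {x : R} (hx : x ∈ A.D (𝟙 e)) : r * x ∈ A.D (𝟙 e) :=
  ((A.D_id_ideal e).2 r trivial x hx).1

theorem mul_mem_right_D_id {e : G} {x : R} (hx : x ∈ A.D (𝟙 e)) (r : R) : x * r ∈ A.D (𝟙 e) :=
  ((A.D_id_ideal e).2 r trivial x hx).2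

theorem eq_zero_of_mem_of_ne {e f : G} (hef : e ≠ f) {x : R} (he : x ∈ A.D (𝟙 e))
    (hf : x ∈ A.D (𝟙 f)) : x = 0 := by
  classical
  have h : DirectSum.of (fun e : G => A.D (𝟙 e)) e ⟨x, he⟩ =
      DirectSum.of (fun e : G => A.D (𝟙 e)) f ⟨x, hf⟩ := by
    refine A.isInternal.injective ?_
    convert (rfl : x = x)
    · exact DirectSum.coeAddMonoidHom_of _ _ _
    · exact DirectSum.coeAddMonoidHom_of _ _ _
  have := DFunLike.congr_fun h e
  rw [DirectSum.of_eq_same, DirectSum.of_eq_of_ne _ _ _ hef] at this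
  exact congrArg Subtype.val this

theorem mul_eq_zero_of_mem_of_ne {e f : G} (hef : e ≠ f) {x y : R} (hx : x ∈ A.D (𝟙 e))
    (hy : y ∈ A.D (𝟙 f)) : x * y = 0 :=
  eq_zero_of_mem_of_ne hef (mul_mem_right_D_id hx y) (mul_mem_left_D_id x hy)

theorem exists_eq_sum (A : PartialGroupoidAction G R) (r : R) :
    ∃ (E : Finset G) (x : G → R), (∀ e, x e ∈ A.D (𝟙 e)) ∧ r = ∑ e ∈ E, x e := by
  classical
  obtain ⟨z, rfl⟩ := A.isInternal.surjective r
  induction z using DirectSum.induction_on with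
  | zero => exact ⟨∅, fun _ => 0, fun e => zero_mem _, by simp⟩
  | of e y =>
    refine ⟨{e}, fun f => if h : f = e then y else 0, fun f => ?_, ?_⟩
    · dsimp only
      split_ifs with h
      · subst h; exact y.2
      · exact zero_mem _
    · simp only [Finset.sum_singleton, dite_true]
      exact DirectSum.coeAddMonoidHom_of _ _ _
  | add y z hy hz =>
    obtain ⟨E, x, hx, h1⟩ := hy
    obtain ⟨F, x', hx', h2⟩ := hz
    refine ⟨E ∪ F, fun e => (if e ∈ E then x e else 0) + if e ∈ F then x' e else 0,
      fun e => add_mem ?_ ?_, ?_⟩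
    · split_ifs
      exacts [hx e, zero_mem _]
    · split_ifs
      exacts [hx' e, zero_mem _]
    · rw [map_add, h1, h2, Finset.sum_add_distrib, Finset.sum_ite_mem, Finset.sum_ite_mem,
        Finset.inter_eq_right.2 Finset.subset_union_left,
        Finset.inter_eq_right.2 Finset.subset_union_right]

@[elab_as_elim]
theorem induction_components (A : PartialGroupoidAction G R) {P : R → Prop} (r : R)
    (mem : ∀ (e : G), ∀ x ∈ A.D (𝟙 e), P x) (zero : P 0)
    (add : ∀ x y, P x → P y → P (x + y)) : P r := by
  obtain ⟨E, x, hx, rfl⟩ := A.exists_eq_sum r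
  exact Finset.sum_induction _ P add zero fun e _ => mem e _ (hx e)

/-! ### The identities of the components -/

variable (hg : A.IsGlobal) (hu : A.IsUnital)

include hu in
theorem exists_one (e : G) : ∃ u ∈ A.D (𝟙 e), ∀ x ∈ A.D (𝟙 e), u * x = x ∧ x * u = x := by
  by_cases h : A.D (𝟙 e) = ⊥
  · refine ⟨0, zero_mem _, fun x hx => ?_⟩
    rw [h] at hx
    rw [NonUnitalSubring.mem_bot.1 hx]
    simp
  · exact hu ⟨e, e, 𝟙 e⟩ h

/-- The identity of `R_e`, which is `0` if `R_e` is zero. -/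
noncomputable def one (e : G) : R := (exists_one hu e).choose

theorem one_mem (e : G) : one hu e ∈ A.D (𝟙 e) := (exists_one hu e).choose_spec.1

theorem one_mul_of_mem {e : G} {x : R} (hx : x ∈ A.D (𝟙 e)) : one hu e * x = x :=
  ((exists_one hu e).choose_spec.2 x hx).1

theorem mul_one_of_mem {e : G} {x : R} (hx : x ∈ A.D (𝟙 e)) : x * one hu e = x :=
  ((exists_one hu e).choose_spec.2 x hx).2

theorem one_mul_mem (e : G) (r : R) : one hu e * r ∈ A.D (𝟙 e) :=
  mul_mem_right_D_id (one_mem hu e) r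

theorem one_mul_of_mem_of_ne {e f : G} (hef : e ≠ f) {x : R} (hx : x ∈ A.D (𝟙 f)) :
    one hu e * x = 0 :=
  mul_eq_zero_of_mem_of_ne hef (one_mem hu e) hx

theorem mul_one_eq_one_mul (e : G) (r : R) : r * one hu e = one hu e * r := by
  refine A.induction_components r (fun f x hx => ?_) ?_ fun x y hx hy => ?_
  · by_cases hef : e = f
    · subst hef; rw [one_mul_of_mem hu hx, mul_one_of_mem hu hx]
    · rw [one_mul_of_mem_of_ne hu hef hx,
        mul_eq_zero_of_mem_of_ne (Ne.symm hef) hx (one_mem hu e)]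
  · simp
  · rw [add_mul, mul_add, hx, hy]

/-- Distinct components annihilate each other, so projection to `R_e` is multiplicative. -/
theorem one_mul_mul (e : G) (r s : R) :
    one hu e * (r * s) = (one hu e * r) * (one hu e * s) := by
  refine A.induction_components r (fun f x hx => ?_) ?_ fun x y hx hy => ?_
  · by_cases hef : e = f
    · subst hef
      rw [one_mul_of_mem hu (mul_mem_right_D_id hx s), one_mul_of_mem hu hx]
      refine A.induction_components s (fun f y hy => ?_) ?_ fun y z hy hz => ?_
      · by_cases hef : e = f
        · subst hef; rw [one_mul_of_mem hu hy]
        · rw [one_mul_of_mem_of_ne hu hef hy, mul_eq_zero_of_mem_of_ne hef hx hy, mul_zero]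
      · simp
      · rw [mul_add, mul_add, mul_add, hy, hz]
    · rw [one_mul_of_mem_of_ne hu hef (mul_mem_right_D_id hx s), one_mul_of_mem_of_ne hu hef hx,
        zero_mul]
  · simp
  · rw [add_mul, mul_add, mul_add, add_mul, hx, hy]

theorem one_mul_mul_of_mem {e : G} {x : R} (hx : x ∈ A.D (𝟙 e)) (r : R) :
    x * (one hu e * r) = x * r := by
  have := one_mul_mul hu e x r
  rwa [one_mul_of_mem hu (mul_mem_right_D_id hx r), one_mul_of_mem hu hx, eq_comm] at this

theorem mul_one_mul_of_mem {e : G} {x : R} (hx : x ∈ A.D (𝟙 e)) (r : R) :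
    (one hu e * r) * x = r * x := by
  have := one_mul_mul hu e r x
  rwa [one_mul_of_mem hu (mul_mem_left_D_id r hx), one_mul_of_mem hu hx, eq_comm] at this

theorem exists_eq_sum_one_mul (r : R) : ∃ E : Finset G, r = ∑ e ∈ E, one hu e * r := by
  obtain ⟨E, x, hx, hr⟩ := A.exists_eq_sum r
  refine ⟨E, hr.trans (Finset.sum_congr rfl fun e he => ?_)⟩
  rw [hr, Finset.mul_sum, Finset.sum_eq_single_of_mem e he fun f _ hf =>
    one_mul_of_mem_of_ne hu (Ne.symm hf) (hx f), one_mul_of_mem hu (hx e)]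

/-! ### Global actions by additive maps of the whole ring -/

include hg in
-- Globality for `g g⁻¹ = 𝟙 b` puts all of `R_b` in the domain of `α_{g⁻¹}`, which is `R_g`.
theorem D_eq {a b : G} (g : a ⟶ b) : A.D g = A.D (𝟙 b) := by
  refine le_antisymm (A.D_ideal g).1 fun x hx => ?_
  have h : x ∈ A.D (Groupoid.inv (Groupoid.inv g ≫ g)) := by simpa using hx
  obtain ⟨hx', -⟩ := ((hg (Groupoid.inv g) g).1 x).1 h
  simpa using hx'

/-- The action of a morphism, extended to all of `R` by zero on the other components. -/
noncomputable def act {a b : G} (g : a ⟶ b) : R →+ R :=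
  AddMonoidHom.mk' (fun r => A.α g ⟨one hu a * r, by rw [D_eq hg]; exact one_mul_mem hu a r⟩)
    fun r s => by
      rw [← AddMemClass.coe_add, ← map_add]
      congr 2
      exact Subtype.ext (mul_add _ _ _)

theorem act_of_mem {a b : G} (g : a ⟶ b) {r : R} (hr : r ∈ A.D (Groupoid.inv g)) :
    act hg hu g r = A.α g ⟨r, hr⟩ := by
  have hr' : r ∈ A.D (𝟙 a) := by rwa [← D_eq hg (Groupoid.inv g)]
  change (A.α g ⟨one hu a * r, _⟩ : R) = _
  congr 2
  exact Subtype.ext (one_mul_of_mem hu hr')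

theorem act_mem {a b : G} (g : a ⟶ b) (r : R) : act hg hu g r ∈ A.D (𝟙 b) :=
  (A.D_ideal g).1 (SetLike.coe_mem _)

theorem act_id (e : G) (r : R) : act hg hu (𝟙 e) r = one hu e * r := A.α_id e _

theorem act_id_of_mem {e : G} {r : R} (hr : r ∈ A.D (𝟙 e)) : act hg hu (𝟙 e) r = r := by
  rw [act_id, one_mul_of_mem hu hr]

theorem act_act {a b c : G} (h : a ⟶ b) (g : b ⟶ c) (r : R) :
    act hg hu g (act hg hu h r) = act hg hu (h ≫ g) r := by
  have hmem : act hg hu h r ∈ A.D (Groupoid.inv g) := by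
    rw [D_eq hg]; exact act_mem hg hu h r
  rw [act_of_mem hg hu g hmem]
  exact A.α_comp h g _ hmem

theorem act_mul {a b : G} (g : a ⟶ b) (r s : R) :
    act hg hu g (r * s) = act hg hu g r * act hg hu g s := by
  change (A.α g _ : R) = A.α g _ * A.α g _
  rw [← MulMemClass.coe_mul, ← map_mul]
  congr 2
  exact Subtype.ext (one_mul_mul hu a r s)

theorem act_act_inv {a b : G} (g : a ⟶ b) {r : R} (hr : r ∈ A.D (𝟙 b)) :
    act hg hu g (act hg hu (Groupoid.inv g) r) = r := by
  rw [act_act, Groupoid.inv_comp, act_id_of_mem hg hu hr]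

theorem coeffMul_eq {a b c : G} (g : b ⟶ c) (h : a ⟶ b) (r : A.ideal ⟨b, c, g⟩)
    (s : A.ideal ⟨a, b, h⟩) :
    A.coeffMul (g := ⟨b, c, g⟩) (h := ⟨a, b, h⟩) rfl r s = r * act hg hu g s := by
  have hr : (r : R) ∈ A.D (𝟙 c) := (A.D_ideal g).1 r.2
  unfold coeffMul
  rw [← act_of_mem hg hu, ← act_of_mem hg hu, act_mul, act_act_inv hg hu g hr]

/-! ### Coefficients of the elements of the skew groupoid ring -/

/-- The coefficient of an element of the skew groupoid ring at a morphism. -/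
noncomputable def coeff (A : PartialGroupoidAction G R) (g : GroupoidMor G) : A.SkewRing →+ R :=
  (AddSubgroupClass.subtype (A.ideal g)).comp
    (DFinsupp.evalAddMonoidHom (β := fun g : GroupoidMor G => A.ideal g) g)

theorem coeff_mem (g : GroupoidMor G) (x : A.SkewRing) : A.coeff g x ∈ A.ideal g :=
  SetLike.coe_mem _

theorem coeff_mem_D_id {a b : G} (m : a ⟶ b) (x : A.SkewRing) :
    A.coeff ⟨a, b, m⟩ x ∈ A.D (𝟙 b) :=
  (A.D_ideal m).1 (coeff_mem ⟨a, b, m⟩ x)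

theorem coeff_single_of_eq {g h : GroupoidMor G} (e : g = h) (r : A.ideal h) :
    A.coeff g (A.single h r) = r := by
  classical
  subst e
  exact congrArg Subtype.val (DirectSum.of_eq_same (β := fun g => A.ideal g) g r)

theorem coeff_single_of_ne {g h : GroupoidMor G} (e : g ≠ h) (r : A.ideal h) :
    A.coeff g (A.single h r) = 0 := by
  classical
  exact congrArg Subtype.val (DirectSum.of_eq_of_ne (β := fun g => A.ideal g) h g r e)

theorem eq_zero_of_coeff {x : A.SkewRing} (h : ∀ g, A.coeff g x = 0) : x = 0 :=
  DFinsupp.ext (β := fun g : GroupoidMor G => A.ideal g) fun g => Subtype.ext (h g)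

@[elab_as_elim]
theorem skewRing_induction {P : A.SkewRing → Prop} (x : A.SkewRing) (zero : P 0)
    (single : ∀ (g : GroupoidMor G) (r : A.ideal g), P (A.single g r))
    (add : ∀ x y, P x → P y → P (x + y)) : P x := by
  classical
  exact DirectSum.induction_on (β := fun g => A.ideal g) x zero single add

/-- The equation `kh = m` has the unique solution `h = k⁻¹m`, so just one coefficient of `x`
contributes. -/
theorem coeff_single_mul {a b c : G} (m : a ⟶ c) (k : b ⟶ c) (r : A.ideal ⟨b, c, k⟩)
    (x : A.SkewRing) : A.coeff ⟨a, c, m⟩ (A.single ⟨b, c, k⟩ r * x) =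
      r * act hg hu k (A.coeff ⟨a, b, m ≫ Groupoid.inv k⟩ x) := by
  refine skewRing_induction x ?_ (fun h s => ?_) fun x y hx hy => ?_
  · simp
  · obtain ⟨a', b', h⟩ := h
    by_cases hb : b' = b
    · subst hb
      rw [single_mul_single_of_comp A rfl]
      by_cases hh : (⟨a, b', m ≫ Groupoid.inv k⟩ : GroupoidMor G) = ⟨a', b', h⟩
      · rw [coeff_single_of_eq hh]
        cases hh
        rw [coeff_single_of_eq (by simp [GroupoidMor.comp])]
        exact coeffMul_eq hg hu k _ r s
      · rw [coeff_single_of_ne hh, map_zero, mul_zero]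
        refine coeff_single_of_ne (fun hm => hh ?_) _
        simp only [GroupoidMor.comp, eqToHom_refl, Category.id_comp] at hm
        cases hm
        simp
    · rw [single_mul_single_of_not_comp A hb, map_zero, coeff_single_of_ne, map_zero, mul_zero]
      exact fun hh => hb (congrArg GroupoidMor.c hh).symm
  · rw [mul_add, map_add, hx, hy, map_add, map_add, mul_add]

theorem coeff_single_mul_of_ne {a b c c' : G} (m : a ⟶ c) (k : b ⟶ c') (hc : c ≠ c')
    (r : A.ideal ⟨b, c', k⟩) (x : A.SkewRing) :
    A.coeff ⟨a, c, m⟩ (A.single ⟨b, c', k⟩ r * x) = 0 := by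
  refine skewRing_induction x ?_ (fun h s => ?_) fun x y hx hy => ?_
  · simp
  · by_cases hb : h.c = b
    · rw [single_mul_single_of_comp A hb, coeff_single_of_ne]
      exact fun hm => hc (congrArg GroupoidMor.c hm)
    · rw [single_mul_single_of_not_comp A hb, map_zero]
  · rw [mul_add, map_add, hx, hy, add_zero]

theorem coeff_mul_single {a b c : G} (m : a ⟶ c) (k : a ⟶ b) (s : A.ideal ⟨a, b, k⟩)
    (x : A.SkewRing) : A.coeff ⟨a, c, m⟩ (x * A.single ⟨a, b, k⟩ s) =
      A.coeff ⟨b, c, Groupoid.inv k ≫ m⟩ x * act hg hu (Groupoid.inv k ≫ m) s := by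
  refine skewRing_induction x ?_ (fun h r => ?_) fun x y hx hy => ?_
  · simp
  · obtain ⟨b', c', h⟩ := h
    by_cases hb : b' = b
    · subst hb
      rw [single_mul_single_of_comp A rfl]
      by_cases hh : (⟨b', c, Groupoid.inv k ≫ m⟩ : GroupoidMor G) = ⟨b', c', h⟩
      · rw [coeff_single_of_eq hh]
        cases hh
        rw [coeff_single_of_eq (by simp [GroupoidMor.comp])]
        exact coeffMul_eq hg hu _ k r s
      · rw [coeff_single_of_ne hh, zero_mul]
        refine coeff_single_of_ne (fun hm => hh ?_) _
        simp only [GroupoidMor.comp, eqToHom_refl, Category.id_comp] at hm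
        cases hm
        simp
    · rw [single_mul_single_of_not_comp A (Ne.symm hb), map_zero, coeff_single_of_ne, zero_mul]
      exact fun hh => hb (congrArg GroupoidMor.d hh).symm
  · rw [add_mul, map_add, hx, hy, map_add, add_mul]

theorem coeff_mul_single_of_ne {a a' b c : G} (m : a ⟶ c) (k : a' ⟶ b) (ha : a ≠ a')
    (s : A.ideal ⟨a', b, k⟩) (x : A.SkewRing) :
    A.coeff ⟨a, c, m⟩ (x * A.single ⟨a', b, k⟩ s) = 0 := by
  refine skewRing_induction x ?_ (fun h r => ?_) fun x y hx hy => ?_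
  · simp
  · by_cases hb : b = h.d
    · rw [single_mul_single_of_comp A hb, coeff_single_of_ne]
      exact fun hm => ha (congrArg GroupoidMor.d hm)
    · rw [single_mul_single_of_not_comp A hb, map_zero]
  · rw [add_mul, map_add, hx, hy, add_zero]

/-! ### Left and right coordinates -/

/-- The coordinates describing left multiplication in the skew groupoid ring. -/
noncomputable def leftCoordinates :
    SkewCoordinates G (AddMonoidHom.mul : R →+ R →+ R)
      (AddMonoidHom.mul : A.SkewRing →+ A.SkewRing →+ A.SkewRing) where
  act := act hg hu
  one := one hu
  coord m := A.coeff ⟨_, _, m⟩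
  single {a b} m := AddMonoidHom.mk' (fun r => A.single ⟨a, b, m⟩
      ⟨one hu b * r, by rw [ideal, D_eq hg]; exact one_mul_mem hu b r⟩) fun r s => by
    rw [← map_add]
    congr 1
    exact Subtype.ext (mul_add _ _ _)
  act_act := act_act hg hu
  act_op := act_mul hg hu
  op_one e r := (act_id hg hu e r).symm
  eq_sum r := by simpa only [act_id] using exists_eq_sum_one_mul hu r
  act_coord m x := act_id_of_mem hg hu (coeff_mem_D_id m x)
  coord_single {a b} m r := (coeff_single_of_eq rfl _).trans (act_id hg hu b r).symm
  coord_single_ne m m' r h := coeff_single_of_ne h _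
  coord_op_single {a b c} m k r x :=
    (coeff_single_mul hg hu m k _ x).trans (mul_one_mul_of_mem hu (act_mem hg hu k _) r)
  coord_op_single_ne m k r x h := coeff_single_mul_of_ne m k h _ x
  ext_zero x h := eq_zero_of_coeff fun g => h _ _ g.hom
  mem_closure x := by
    refine skewRing_induction x (zero_mem _) (fun g r => ?_) fun x y => add_mem
    refine AddSubgroup.subset_closure ⟨g.d, g.c, g.hom, r, ?_⟩
    exact congrArg (A.single g) (Subtype.ext (one_mul_of_mem hu ((A.D_ideal g.hom).1 r.2)))

/-- The coordinates describing right multiplication in the skew groupoid ring. -/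
noncomputable def rightCoordinates :
    SkewCoordinates G (AddMonoidHom.mul : R →+ R →+ R).flip
      (AddMonoidHom.mul : A.SkewRing →+ A.SkewRing →+ A.SkewRing).flip where
  act := act hg hu
  one := one hu
  -- Inversion turns right multiplication into left form; `α_m` moves the coefficient at `m⁻¹` from
  -- `R_{d(m)}` to `R_{c(m)}`, so the new factor is not twisted.
  coord m := (act hg hu m).comp (A.coeff ⟨_, _, Groupoid.inv m⟩)
  single {a b} m := AddMonoidHom.mk' (fun r => A.single ⟨b, a, Groupoid.inv m⟩
      ⟨act hg hu (Groupoid.inv m) r, by rw [ideal, D_eq hg]; exact act_mem hg hu _ r⟩)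
    fun r s => by
      rw [← map_add]
      congr 1
      exact Subtype.ext (map_add _ _ _)
  act_act := act_act hg hu
  act_op g r s := act_mul hg hu g s r
  op_one e r := (mul_one_eq_one_mul hu e r).trans (act_id hg hu e r).symm
  eq_sum r := by simpa only [act_id] using exists_eq_sum_one_mul hu r
  act_coord m x := act_id_of_mem hg hu (act_mem hg hu m _)
  coord_single {a b} m r := by
    refine (congrArg (act hg hu m) (coeff_single_of_eq rfl _)).trans ?_
    rw [act_act, Groupoid.inv_comp]
  coord_single_ne m m' r h := by
    refine (congrArg (act hg hu m) (coeff_single_of_ne (fun hm => h ?_) _)).trans (map_zero _)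
    have := congrArg (fun g : GroupoidMor G =>
      (⟨g.c, g.d, Groupoid.inv g.hom⟩ : GroupoidMor G)) hm
    simpa using this
  coord_op_single {a b c} m k r x := by
    refine (congrArg (act hg hu m) (coeff_mul_single hg hu (Groupoid.inv m) (Groupoid.inv k)
      _ x)).trans ?_
    change _ = act hg hu k (act hg hu (m ≫ Groupoid.inv k)
      (A.coeff ⟨_, _, Groupoid.inv (m ≫ Groupoid.inv k)⟩ x)) * r
    rw [act_mul, act_act, act_act, act_act]
    simp only [Groupoid.inv_eq_inv, IsIso.inv_comp, IsIso.inv_inv, Category.assoc,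
      IsIso.inv_hom_id, Category.comp_id]
    rw [act_id, one_mul_mul_of_mem hu (act_mem hg hu m _)]
  coord_op_single_ne m k r x h :=
    (congrArg (act hg hu m) (coeff_mul_single_of_ne _ _ h _ x)).trans (map_zero _)
  ext_zero x h := eq_zero_of_coeff fun ⟨a, b, m⟩ => by
    have h1 := congrArg (act hg hu m) (h _ _ (Groupoid.inv m))
    rw [AddMonoidHom.comp_apply, act_act, map_zero, Groupoid.inv_comp, act_id_of_mem] at h1
    · simpa using h1
    · exact coeff_mem_D_id _ x
  mem_closure x := by
    refine skewRing_induction x (zero_mem _) (fun ⟨a, b, m⟩ r => ?_) fun x y => add_mem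
    refine AddSubgroup.subset_closure ⟨b, a, Groupoid.inv m, act hg hu (Groupoid.inv m) r, ?_⟩
    refine eq_of_sub_eq_zero (eq_zero_of_coeff fun g => ?_)
    have he : (⟨a, b, Groupoid.inv (Groupoid.inv m)⟩ : GroupoidMor G) = ⟨a, b, m⟩ := by simp
    rw [map_sub, sub_eq_zero]
    by_cases hgm : g = ⟨a, b, m⟩
    · refine (coeff_single_of_eq (hgm.trans he.symm) _).trans
        (Eq.trans ?_ (coeff_single_of_eq hgm r).symm)
      have hr : (r : R) ∈ A.D (𝟙 b) := (A.D_ideal m).1 r.2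
      change act hg hu (Groupoid.inv (Groupoid.inv m)) (act hg hu (Groupoid.inv m) r) = r
      rw [act_act, Groupoid.comp_inv, act_id_of_mem hg hu hr]
    · exact (coeff_single_of_ne (fun h => hgm (h.trans he)) _).trans
        (coeff_single_of_ne hgm r).symm

theorem act_id_ne_zero_iff (m : GroupoidMor G) :
    act hg hu (𝟙 m.c) ≠ 0 ↔ A.ideal m ≠ ⊥ := by
  rw [not_iff_not, ideal, D_eq hg]
  constructor
  · intro h
    rw [eq_bot_iff]
    intro x hx
    rw [← act_id_of_mem hg hu hx, h]
    exact zero_mem _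
  · intro h
    ext r
    have := act_mem hg hu (𝟙 m.c) r
    rw [h] at this
    exact NonUnitalSubring.mem_bot.1 this

end PartialGroupoidAction

theorem theorem1p2 {G : Type*} [Groupoid G] {R : Type*} [NonUnitalNonAssocRing R]
    (A : PartialGroupoidAction G R) (hglobal : A.IsGlobal) (hunital : A.IsUnital) :
    (IsLeftArtinian A.SkewRing ↔
      IsLeftArtinian R ∧ {g : GroupoidMor G | A.ideal g ≠ ⊥}.Finite) ∧
    (IsRightArtinian A.SkewRing ↔
      IsRightArtinian R ∧ {g : GroupoidMor G | A.ideal g ≠ ⊥}.Finite) := by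
  have hset : {g : GroupoidMor G | A.ideal g ≠ ⊥} =
      {g | PartialGroupoidAction.act hglobal hunital (𝟙 g.c) ≠ 0} :=
    Set.ext fun g => (PartialGroupoidAction.act_id_ne_zero_iff hglobal hunital g).symm
  rw [hset]
  -- Both artinian conditions unfold definitionally to `ChainCondition`, the right one for the
  -- flipped multiplications.
  exact ⟨(PartialGroupoidAction.leftCoordinates hglobal hunital).chainCondition_iff,
    (PartialGroupoidAction.rightCoordinates hglobal hunital).chainCondition_iff⟩
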